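/- An $L$-bit adjacency labeling scheme for $n$-vertex undirected graphs is a pair of functions: $\mathrm{Label}$, which assigns to every simple undirected graph $G$ on the vertex set $[n]=\{0,1,\dots,n-1\}$ and every vertex $u\in[n]$ a label $\mathrm{Label}(G)(u)\in\{0,1\}^L$, and a symmetric function $\mathrm{Edge}:\{0,1\}^L\times\{0,1\}^L\to\{0,1\}$, not depending on $G$, such that for every such graph $G$ and all $u,v\in[n]$, the vertices $u$ and $v$ are adjacent in $G$ if and only if $\mathrm{Edge}(\mathrm{Label}(G)(u),\mathrm{Label}(G)(v))=1$. The scheme has the distinctness property if $\mathrm{Label}(G)(u)\neq\mathrm{Label}(G)(v)$ for every $G$ and all $u\ne v$. It is indexing if there is a function $\mathrm{Ind}:\{0,1\}^L\to[n]$, not depending on $G$, such that $\mathrm{Ind}(\mathrm{Label}(G)(u))\neq \mathrm{Ind}(\mathrm{Label}(G)(v))$ for every $G$ and all $u\neq v$. A graph $\mathcal G$ is induced-universal for $n$-vertex graphs if every simple undirected graph on $n$ vertices is isomorphic to an induced subgraph of $\mathcal G$. Theorem. For every $n\ge 100$ there is an $L$-bit adjacency labeling scheme for $n$-vertex undirected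 graphs with $L=\lceil n/2\rceil+4$, and it can be chosen to be indexing and to have the distinctness property. Consequently, there are finite graphs $\mathcal G_n$ ($n\ge 0$), with $O(2^{n/2})$ vertices, such that $\mathcal G_n$ is induced-universal for $n$-vertex undirected graphs. -/

import Mathlib

open Asymptotics Filter

/-- An `L`-bit adjacency labeling scheme for a family `F` of undirected graphs on the vertex set
`{0, …, n-1}`: an encoder `label` that assigns an `L`-bit label to every vertex of every graph of
the family, and a decoder `edge`, the same for all graphs of the family, that decides from two
labels alone whether their vertices are adjacent. As the graphs are undirected, the decoder is
required to be symmetric on all pairs of bit strings. -/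
structure AdjacencyLabelingScheme {n : ℕ} (F : Set (SimpleGraph (Fin n))) (L : ℕ) where
  label : F → Fin n → (Fin L → Bool)
  edge : (Fin L → Bool) → (Fin L → Bool) → Bool
  edge_symm : ∀ x y, edge x y = edge y x
  adj_iff : ∀ (G : F) (u v : Fin n),
    (G : SimpleGraph (Fin n)).Adj u v ↔ edge (label G u) (label G v) = true

/-- The scheme satisfies the distinctness property: within each graph, distinct vertices get
distinct labels. -/
def AdjacencyLabelingScheme.Distinct {n : ℕ} {F : Set (SimpleGraph (Fin n))} {L : ℕ}
    (S : AdjacencyLabelingScheme F L) : Prop :=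
  ∀ (G : F) (u v : Fin n), u ≠ v → S.label G u ≠ S.label G v

/-- The scheme is indexing: a single function of the label, the same for all graphs of the family,
gives the vertices of each graph distinct indices in `{0, …, n-1}` (not necessarily their
original names). -/
def AdjacencyLabelingScheme.Indexing {n : ℕ} {F : Set (SimpleGraph (Fin n))} {L : ℕ}
    (S : AdjacencyLabelingScheme F L) : Prop :=
  ∃ ind : (Fin L → Bool) → Fin n,
    ∀ (G : F) (u v : Fin n), u ≠ v → ind (S.label G u) ≠ ind (S.label G v)

/-- `U` is induced-universal for the family `F`: every graph of `F` is isomorphic to an induced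
subgraph of `U`. -/
def IsInducedUniversal {W : Type*} (U : SimpleGraph W) {n : ℕ}
    (F : Set (SimpleGraph (Fin n))) : Prop :=
  ∀ G ∈ F, G.IsIndContained U

/-!
Numbering the vertices and letting each one store its adjacency to half of the others takes
`n / 2 + log n` bits. The logarithm is saved by choosing the numbering depending on the graph, so
that a vertex number also carries information about adjacency to a few special vertices.

Let `2 ^ (t + 2) < n ≤ 2 ^ (t + 3)`. There are `2 * t + 1` special vertices: a root, and `t` for
each half of the remaining, ordinary vertices. One half is filled with vertices on which adjacency
to the root is constant, by majority (`exists_perm_const_on_half`). Each half is then sorted in Gray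
order with respect to the adjacency to its `t` special vertices, so that the adjacency to special
vertex number `j` changes only `2 ^ j` times along the half (`exists_perm_odd_monotone`). Such a
column is cheap to store (`card_changeSets_le`), and the special vertex stores it, so that ordinary
vertices of this half pay nothing for that pair. For the other half, the special vertex stores
single bits, as many as fit into its label. Hence ordinary vertices pay for few of their pairs
with special vertices, and almost half of `n - 2 * t - 1` bits for the pairs among themselves:
as `t` is `log n` up to a constant, this makes up for the number of the vertex in its label.

To get the additive constant `4`, the pairs that need a bit of their own are distributed by Hall's
theorem: it suffices to charge them to their endpoints in fractions within the capacities
(`exists_injective_slot`, `Idx.exists_slots`). Moreover the capacity may vary with the index, as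
only the total number of labels matters (`exists_scheme_of_codebooks`). The codes of all special
vertices together take at most `2 ^ (t + 3) + 3 / 8 * n` bits or so (`sum_codeLength_le`), and what
remains of the budget is linear in `n`, against lower order terms quadratic in `t`
(`budget_inequality`).

The induced-universal graphs are the decoders, viewed as graphs on all bit strings.
-/

/-! ### From fractional to integral orientations -/

open Classical in
/-- Let every pair of the asymmetric relation `r` be charged to its two endpoints in fractions
`w u x` and `w x u` that add up to at least `1`, with total charge at most `cap u` at each `u`.
Then the pairs can be stored in distinct slots, each at one of its endpoints, with `cap u` slots
at `u`: summing the charges gives Hall's condition. -/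
theorem exists_injective_slot {V : Type*} [Fintype V] (r : V → V → Prop)
    (hr : ∀ u x, r u x → ¬ r x u) (w : V → V → ℝ) (hw0 : ∀ u x, 0 ≤ w u x)
    (hw : ∀ u x, r u x → 1 ≤ w u x + w x u) (cap : V → ℕ)
    (hcap : ∀ u, ∑ x, w u x ≤ cap u) :
    ∃ φ : {p : V × V // r p.1 p.2} → (Σ u, Fin (cap u)), Function.Injective φ ∧
      ∀ p, (φ p).1 = p.1.1 ∨ (φ p).1 = p.1.2 := by
  let T : {p : V × V // r p.1 p.2} → Finset (Σ u, Fin (cap u)) :=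
    fun p => Finset.univ.filter fun z => z.1 = p.1.1 ∨ z.1 = p.1.2
  suffices h : ∀ s : Finset {p : V × V // r p.1 p.2}, s.card ≤ (s.biUnion T).card by
    obtain ⟨φ, hφ, hT⟩ := (Finset.all_card_le_biUnion_card_iff_exists_injective T).1 h
    exact ⟨φ, hφ, fun p => by simpa [T] using hT p⟩
  intro s
  let U : Finset V := s.image (fun p => p.1.1) ∪ s.image (fun p => p.1.2)
  have hU : s.biUnion T = U.sigma fun _ => Finset.univ := by
    ext ⟨u, k⟩
    simp only [T, U, Finset.mem_biUnion, Finset.mem_filter, Finset.mem_univ, true_and,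
      Finset.mem_sigma, Finset.mem_union, Finset.mem_image, and_true]
    constructor
    · rintro ⟨p, hp, h | h⟩
      · exact Or.inl ⟨p, hp, h.symm⟩
      · exact Or.inr ⟨p, hp, h.symm⟩
    · rintro (⟨p, hp, h⟩ | ⟨p, hp, h⟩)
      · exact ⟨p, hp, Or.inl h.symm⟩
      · exact ⟨p, hp, Or.inr h.symm⟩
  let s₁ : Finset (V × V) := s.image (fun p => p.1)
  let s₂ : Finset (V × V) := s.image (fun p => p.1.swap)
  have hdisj : Disjoint s₁ s₂ := by
    rw [Finset.disjoint_left]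
    intro z h₁ h₂
    obtain ⟨p, -, rfl⟩ := Finset.mem_image.1 h₁
    obtain ⟨p', -, h⟩ := Finset.mem_image.1 h₂
    have h3 := p'.2
    have h4 := p.2
    rw [← h] at h4
    exact hr _ _ h3 h4
  have hsub : s₁ ∪ s₂ ⊆ U ×ˢ Finset.univ := by
    intro z hz
    simp only [Finset.mem_product, Finset.mem_univ, and_true, U, Finset.mem_union,
      Finset.mem_image]
    rcases Finset.mem_union.1 hz with h | h
    · obtain ⟨p, hp, rfl⟩ := Finset.mem_image.1 h
      exact Or.inl ⟨p, hp, rfl⟩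
    · obtain ⟨p, hp, rfl⟩ := Finset.mem_image.1 h
      exact Or.inr ⟨p, hp, rfl⟩
  have key : (s.card : ℝ) ≤ ((s.biUnion T).card : ℝ) := by
    calc (s.card : ℝ) = ∑ p ∈ s, (1 : ℝ) := by simp
      _ ≤ ∑ p ∈ s, (w p.1.1 p.1.2 + w p.1.2 p.1.1) := Finset.sum_le_sum fun p _ => hw _ _ p.2
      _ = ∑ z ∈ s₁, w z.1 z.2 + ∑ z ∈ s₂, w z.1 z.2 := by
          rw [Finset.sum_add_distrib, Finset.sum_image, Finset.sum_image]
          · rfl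
          · intro p _ p' _ h
            exact Subtype.ext (Prod.swap_injective h)
          · intro p _ p' _ h
            exact Subtype.ext h
      _ = ∑ z ∈ s₁ ∪ s₂, w z.1 z.2 := (Finset.sum_union hdisj).symm
      _ ≤ ∑ z ∈ U ×ˢ Finset.univ, w z.1 z.2 :=
          Finset.sum_le_sum_of_subset_of_nonneg hsub fun z _ _ => hw0 _ _
      _ = ∑ u ∈ U, ∑ x, w u x := by rw [Finset.sum_product]
      _ ≤ ∑ u ∈ U, (cap u : ℝ) := Finset.sum_le_sum fun u _ => hcap u
      _ = ((s.biUnion T).card : ℝ) := by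
          rw [hU, Finset.card_sigma]
          simp
  exact_mod_cast key

/-! ### Labeling schemes from codebooks and slots -/

open Classical in
/-- A labeling scheme built from an index set `I`. The vertices of `G` are placed at the indices by
some `σ`, chosen depending on `G`. The label of the vertex at `i` consists of `i`, of an element of
the codebook `C i` which tells the adjacency to all `j` with `thr i j`, and of `cap i` further
bits, in which the remaining pairs (related by `r`) are stored at the places given by `φ`. The
labels need not have a fixed format: it suffices that there are at most `2 ^ L` of them. -/
theorem exists_scheme_of_codebooks {n L : ℕ} (hn : 0 < n) {I κ : Type} [Fintype I]
    (e : I ≃ Fin n) (thr : I → I → Prop) (C : I → Finset κ) (col : I → κ → I → Prop)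
    (cap : I → ℕ) (r : I → I → Prop)
    (φ : {p : I × I // r p.1 p.2} → (Σ u, Fin (cap u))) (hφ : Function.Injective φ)
    (hends : ∀ p, (φ p).1 = p.1.1 ∨ (φ p).1 = p.1.2)
    (hcover : ∀ i j, i ≠ j → thr i j ∨ thr j i ∨ r i j ∨ r j i)
    (hcard : ∑ i, (C i).card * 2 ^ cap i ≤ 2 ^ L)
    (hG : ∀ G : SimpleGraph (Fin n), ∃ σ : I ≃ Fin n, ∀ i, ∃ k ∈ C i, ∀ j, thr i j →
      (G.Adj (σ i) (σ j) ↔ col i k j)) :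
    ∃ S : AdjacencyLabelingScheme (Set.univ : Set (SimpleGraph (Fin n))) L,
      S.Distinct ∧ S.Indexing := by
  let Λ : Type := Σ i, (C i) × (Fin (cap i) → Bool)
  have hΛ : Fintype.card Λ ≤ Fintype.card (Fin L → Bool) := by
    simpa [Λ, Fintype.card_sigma] using hcard
  obtain ⟨emb⟩ := Function.Embedding.nonempty_of_card_le hΛ
  choose σ k hk hcol using hG
  let lab (G : SimpleGraph (Fin n)) (u : Fin n) : Λ :=
    ⟨(σ G).symm u, ⟨k G _, hk G _⟩, fun s => decide (∃ p, φ p = ⟨(σ G).symm u, s⟩ ∧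
      G.Adj (σ G p.1.1) (σ G p.1.2))⟩
  -- The evidence for adjacency that is available when `x` is the responsible endpoint, or the
  -- first endpoint of a pair that has a bit of its own.
  let H : Λ → Λ → Prop := fun x y => (thr x.1 y.1 ∧ col x.1 x.2.1 y.1) ∨
    ∃ p : {p : I × I // r p.1 p.2}, p.1 = (x.1, y.1) ∧
      ((∃ s, φ p = ⟨x.1, s⟩ ∧ x.2.2 s = true) ∨ (∃ s, φ p = ⟨y.1, s⟩ ∧ y.2.2 s = true))
  have hbit : ∀ (G : SimpleGraph (Fin n)) (p : {p : I × I // r p.1 p.2}) (u : Fin n)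
      (s : Fin (cap ((σ G).symm u))), φ p = ⟨(σ G).symm u, s⟩ →
      ((lab G u).2.2 s = true ↔ G.Adj (σ G p.1.1) (σ G p.1.2)) := by
    intro G p u s h
    simp only [lab, decide_eq_true_eq]
    constructor
    · rintro ⟨p', h', ha⟩
      rwa [hφ (h'.trans h.symm)] at ha
    · exact fun ha => ⟨p, h, ha⟩
  have hH : ∀ (G : SimpleGraph (Fin n)) (u v : Fin n), H (lab G u) (lab G v) → G.Adj u v := by
    rintro G u v (⟨ht, hc⟩ | ⟨p, hp, ⟨s, h1, h2⟩ | ⟨s, h1, h2⟩⟩)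
    · simpa [lab] using (hcol G _ _ ht).2 hc
    · simpa [hp, lab] using (hbit G p u s h1).1 h2
    · simpa [hp, lab] using (hbit G p v s h1).1 h2
  have hH' : ∀ (G : SimpleGraph (Fin n)) (u v : Fin n), G.Adj u v →
      thr ((σ G).symm u) ((σ G).symm v) ∨ r ((σ G).symm u) ((σ G).symm v) →
      H (lab G u) (lab G v) := by
    rintro G u v ha (h | h)
    · exact Or.inl ⟨h, (hcol G _ _ h).1 (by simpa using ha)⟩
    · refine Or.inr ⟨⟨(_, _), h⟩, rfl, ?_⟩
      rcases hends ⟨(_, _), h⟩ with h' | h'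
      · left
        obtain ⟨s, hs⟩ : ∃ s, φ ⟨(_, _), h⟩ = ⟨(σ G).symm u, s⟩ := by
          generalize φ ⟨(_, _), h⟩ = z at h'
          obtain ⟨z1, z2⟩ := z
          simp only at h'
          subst h'
          exact ⟨z2, rfl⟩
        exact ⟨s, hs, (hbit G _ u s hs).2 (by simpa using ha)⟩
      · right
        obtain ⟨s, hs⟩ : ∃ s, φ ⟨(_, _), h⟩ = ⟨(σ G).symm v, s⟩ := by
          generalize φ ⟨(_, _), h⟩ = z at h'
          obtain ⟨z1, z2⟩ := z
          simp only at h'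
          subst h'
          exact ⟨z2, rfl⟩
        exact ⟨s, hs, (hbit G _ v s hs).2 (by simpa using ha)⟩
  have hlab : ∀ (G : SimpleGraph (Fin n)) (u v : Fin n), u ≠ v →
      (lab G u).1 ≠ (lab G v).1 := fun G u v h h' => h ((σ G).symm.injective h')
  let ind : (Fin L → Bool) → Fin n := fun x =>
    if h : ∃ a : Λ, emb a = x then e h.choose.1 else ⟨0, hn⟩
  have hind : ∀ a : Λ, ind (emb a) = e a.1 := by
    intro a
    have h : ∃ a' : Λ, emb a' = emb a := ⟨a, rfl⟩
    simp only [ind, dif_pos h]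
    rw [emb.injective h.choose_spec]
  refine ⟨{
    label := fun G u => emb (lab G u)
    edge := fun x y => decide (∃ a b, emb a = x ∧ emb b = y ∧ (H a b ∨ H b a))
    edge_symm := ?_
    adj_iff := ?_ }, ?_, ind, ?_⟩
  · intro x y
    rw [decide_eq_decide]
    constructor <;> rintro ⟨a, b, ha, hb, h⟩ <;> exact ⟨b, a, hb, ha, h.symm⟩
  · intro G u v
    rw [decide_eq_true_eq]
    constructor
    · intro ha
      refine ⟨_, _, rfl, rfl, ?_⟩
      have hne : (σ G).symm u ≠ (σ G).symm v := fun h => G.1.ne_of_adj ha ((σ G).symm.injective h)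
      rcases hcover _ _ hne with h | h | h | h
      · exact Or.inl (hH' G u v ha (Or.inl h))
      · exact Or.inr (hH' G v u ha.symm (Or.inl h))
      · exact Or.inl (hH' G u v ha (Or.inr h))
      · exact Or.inr (hH' G v u ha.symm (Or.inr h))
    · rintro ⟨a, b, ha, hb, h⟩
      rw [emb.injective ha, emb.injective hb] at h
      rcases h with h | h
      · exact hH G u v h
      · exact (hH G v u h).symm
  · intro G u v huv h
    exact hlab G u v huv (congrArg Sigma.fst (emb.injective h))
  · intro G u v huv h
    simp only [hind] at h
    exact hlab G u v huv (e.injective h)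

/-! ### Sorting in Gray order -/

/-- The rank, in the reflected Gray order, of the word `x 0 p, …, x (j - 1) p`: each new binary
digit of the rank is the new letter of the word, flipped if the rank so far is odd. -/
def grayKey {α : Type*} (x : ℕ → α → Bool) : ℕ → α → ℕ
  | 0, _ => 0
  | j + 1, p => 2 * grayKey x j p + if x j p = decide (grayKey x j p % 2 = 1) then 0 else 1

theorem grayKey_lt {α : Type*} (x : ℕ → α → Bool) (j : ℕ) (p : α) : grayKey x j p < 2 ^ j := by
  induction j with
  | zero => simp [grayKey]
  | succ j ih =>
    rw [grayKey, pow_succ]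
    split_ifs <;> omega

theorem grayKey_succ_div_two {α : Type*} (x : ℕ → α → Bool) (j : ℕ) (p : α) :
    grayKey x (j + 1) p / 2 = grayKey x j p := by
  rw [grayKey]
  split_ifs <;> omega

theorem grayKey_add_div {α : Type*} (x : ℕ → α → Bool) (j i : ℕ) (p : α) :
    grayKey x (j + i) p / 2 ^ i = grayKey x j p := by
  induction i with
  | zero => simp
  | succ i ih =>
    rw [pow_succ', ← Nat.div_div_eq_div_mul, ← add_assoc, grayKey_succ_div_two, ih]

/-- A letter of the word is the exclusive or of two consecutive binary digits of the rank, which is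
the parity of a monotone function of the rank. -/
theorem odd_half_grayKey {α : Type*} (x : ℕ → α → Bool) (j : ℕ) (p : α) :
    Odd ((grayKey x (j + 1) p + 1) / 2) ↔ x j p = true := by
  rw [Nat.odd_iff, grayKey]
  rcases Nat.mod_two_eq_zero_or_one (grayKey x j p) with h | h <;>
    cases hx : x j p <;> simp [h] <;> omega

/-- After sorting in Gray order, column `j` is the parity of a monotone function bounded by `2 ^ j`,
so that it changes at most `2 ^ j` times. -/
theorem exists_perm_odd_monotone {q : ℕ} (x : ℕ → Fin q → Bool) (t : ℕ) :
    ∃ σ : Equiv.Perm (Fin q), ∀ j < t, ∃ F : Fin q → ℕ, Monotone F ∧ (∀ p, F p ≤ 2 ^ j) ∧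
      ∀ p, x j (σ p) = true ↔ Odd (F p) := by
  refine ⟨Tuple.sort (grayKey x t), fun j hj => ?_⟩
  obtain ⟨i, rfl⟩ : ∃ i, t = j + 1 + i := ⟨t - (j + 1), by omega⟩
  set σ := Tuple.sort (grayKey x (j + 1 + i))
  refine ⟨fun p => (grayKey x (j + 1) (σ p) + 1) / 2, ?_, ?_, ?_⟩
  · intro p p' h
    have h1 : grayKey x (j + 1 + i) (σ p) ≤ grayKey x (j + 1 + i) (σ p') :=
      Tuple.monotone_sort (grayKey x (j + 1 + i)) h
    have h2 := Nat.div_le_div_right (c := 2 ^ i) h1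
    rw [grayKey_add_div, grayKey_add_div] at h2
    dsimp only
    omega
  · intro p
    have := grayKey_lt x (j + 1) (σ p)
    rw [pow_succ] at this
    dsimp only
    omega
  · intro p
    exact (odd_half_grayKey x j (σ p)).symm

/-- The parity of a monotone function is recovered by counting its changes of parity. The bound
`F (q - 1)` also counts a change before position `0` if `F 0` is odd. -/
theorem exists_changes_of_monotone {F : ℕ → ℕ} (hF : Monotone F) (q : ℕ) :
    ∃ D ⊆ Finset.range q, D.card ≤ F (q - 1) ∧
      ∀ p < q, (Odd (F p) ↔ Odd (D.filter (· ≤ p)).card) := by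
  induction q with
  | zero => exact ⟨∅, by simp⟩
  | succ q ih =>
    obtain ⟨D, hD, hc, hp⟩ := ih
    have hlast : 0 < q → (Odd (F (q - 1)) ↔ Odd D.card) := by
      intro hq
      rw [hp (q - 1) (by omega), Finset.filter_true_of_mem]
      intro d hd
      have := Finset.mem_range.1 (hD hd)
      omega
    have hmono : F (q - 1) ≤ F q := hF (by omega)
    have hqD : q ∉ D := fun h => by simpa using hD h
    have hle : ∀ d ∈ D, d ≤ q := fun d hd => (Finset.mem_range.1 (hD hd)).le
    by_cases hpar : Odd (F q) ↔ Odd D.card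
    · refine ⟨D, hD.trans (Finset.range_mono (by omega)), by simpa using hc.trans hmono, ?_⟩
      intro p hpq
      rcases Nat.lt_succ_iff_lt_or_eq.1 hpq with h | rfl
      · exact hp p h
      · rw [hpar, Finset.filter_true_of_mem hle]
    · refine ⟨insert q D, ?_, ?_, ?_⟩
      · intro d hd
        rcases Finset.mem_insert.1 hd with rfl | h
        · simp
        · exact Finset.mem_range.2 (by have := Finset.mem_range.1 (hD h); omega)
      · rw [Finset.card_insert_of_notMem hqD, Nat.add_sub_cancel]
        rcases Nat.eq_zero_or_pos q with rfl | hq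
        · have : D = ∅ := by simpa using hD
          subst this
          have h0 : F 0 ≠ 0 := by
            intro h
            simp [h] at hpar
          simp
          omega
        · have : F (q - 1) ≠ F q := fun h => hpar (h ▸ hlast hq)
          omega
      · intro p hpq
        rcases Nat.lt_succ_iff_lt_or_eq.1 hpq with h | rfl
        · rw [Finset.filter_insert, if_neg (by omega)]
          exact hp p h
        · rw [Finset.filter_insert, if_pos le_rfl, Finset.filter_true_of_mem hle,
            Finset.card_insert_of_notMem hqD, Nat.odd_add_one]
          tauto

/-! ### The codebook of columns with few changes -/

/-- The sets of at most `m` positions among the first `q`. -/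
def changeSets (q m : ℕ) : Finset (Finset ℕ) :=
  (Finset.range q).powerset.filter fun D => D.card ≤ m

theorem exists_mem_changeSets {q m : ℕ} {F : Fin q → ℕ} (hF : Monotone F) (hm : ∀ p, F p ≤ m) :
    ∃ D ∈ changeSets q m, ∀ p : Fin q, Odd (F p) ↔ Odd (D.filter (· ≤ (p : ℕ))).card := by
  let F' : ℕ → ℕ := fun p => if h : p < q then F ⟨p, h⟩ else m
  have hF' : Monotone F' := by
    intro p p' h
    dsimp only [F']
    split_ifs with h1 h2 h2
    · exact hF h
    · exact hm _
    · omega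
    · exact le_rfl
  obtain ⟨D, hD, hc, hp⟩ := exists_changes_of_monotone hF' q
  refine ⟨D, ?_, fun p => ?_⟩
  · rw [changeSets, Finset.mem_filter, Finset.mem_powerset]
    refine ⟨hD, hc.trans ?_⟩
    dsimp only [F']
    split_ifs
    · exact hm _
    · exact le_rfl
  · rw [← hp p p.2]
    simp [F']

/-- This is `(1 + y) ^ q ≤ exp (y * q) ≤ 2 ^ (3 / 2 * y * q)` for `y = 2 ^ (-i)`. -/
theorem one_add_inv_two_pow_pow_le (q i : ℕ) :
    (1 + (1 / 2 : ℝ) ^ i) ^ q ≤ 2 ^ (3 * q / 2 ^ (i + 1) + 1) := by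
  have hy : (0 : ℝ) < (1 / 2 : ℝ) ^ i := by positivity
  have he : Real.exp 1 ≤ (2 : ℝ) ^ (3 / 2 : ℝ) := by
    have h1 := Real.exp_one_lt_d9
    have h2 : ((2 : ℝ) ^ (3 / 2 : ℝ)) ^ 2 = 8 := by
      rw [← Real.rpow_natCast, ← Real.rpow_mul (by norm_num)]
      norm_num
    have h3 : (0 : ℝ) ≤ (2 : ℝ) ^ (3 / 2 : ℝ) := by positivity
    nlinarith [Real.exp_pos 1]
  calc (1 + (1 / 2 : ℝ) ^ i) ^ q ≤ (Real.exp ((1 / 2 : ℝ) ^ i)) ^ q := by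
        gcongr
        rw [add_comm]
        exact Real.add_one_le_exp _
    _ = (Real.exp 1) ^ ((1 / 2 : ℝ) ^ i * q) := by
        rw [← Real.exp_nat_mul, ← Real.exp_mul]
        ring_nf
    _ ≤ ((2 : ℝ) ^ (3 / 2 : ℝ)) ^ ((1 / 2 : ℝ) ^ i * q) := by
        gcongr
    _ = (2 : ℝ) ^ ((3 * q : ℝ) / 2 ^ (i + 1)) := by
        rw [← Real.rpow_mul (by norm_num)]
        congr 1
        rw [div_pow, pow_succ, one_pow]
        field_simp
    _ ≤ (2 : ℝ) ^ ((3 * q / 2 ^ (i + 1) + 1 : ℕ) : ℝ) := by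
        apply Real.rpow_le_rpow_of_exponent_le (by norm_num)
        have := Nat.lt_floor_add_one ((3 * q : ℝ) / 2 ^ (i + 1))
        have h2 : ⌊(3 * q : ℝ) / 2 ^ (i + 1)⌋₊ = 3 * q / 2 ^ (i + 1) := by
          have := Nat.floor_div_eq_div (K := ℝ) (3 * q) (2 ^ (i + 1))
          push_cast at this
          exact this
        rw [h2] at this
        push_cast at this ⊢
        linarith
    _ = 2 ^ (3 * q / 2 ^ (i + 1) + 1) := by rw [Real.rpow_natCast]

/-- With the weight `y ^ #D`, where `y = 2 ^ (-i)`, every set in the codebook has weight at least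
`y ^ m`, and all subsets of the `q` positions together have weight `(1 + y) ^ q`. -/
theorem card_changeSets_le (q m i : ℕ) :
    (changeSets q m).card ≤ 2 ^ (m * i + 3 * q / 2 ^ (i + 1) + 1) := by
  have hy : (0 : ℝ) < (1 / 2 : ℝ) ^ i := by positivity
  have hy1 : (1 / 2 : ℝ) ^ i ≤ 1 := pow_le_one₀ (by norm_num) (by norm_num)
  have h1 : ((changeSets q m).card : ℝ) * ((1 / 2 : ℝ) ^ i) ^ m ≤ (1 + (1 / 2 : ℝ) ^ i) ^ q := by
    have h2 := Finset.sum_pow_mul_eq_add_pow ((1 / 2 : ℝ) ^ i) 1 (Finset.range q)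
    rw [Finset.card_range] at h2
    rw [add_comm 1, ← h2, ← nsmul_eq_mul, ← Finset.sum_const]
    refine (Finset.sum_le_sum fun D hD => ?_).trans
      (Finset.sum_le_sum_of_subset_of_nonneg (Finset.filter_subset _ _) fun _ _ _ => by positivity)
    rw [one_pow, mul_one]
    exact pow_le_pow_of_le_one hy.le hy1 (Finset.mem_filter.1 hD).2
  have h3 : ((1 / 2 : ℝ) ^ i) ^ m * 2 ^ (m * i) = 1 := by
    rw [← pow_mul, mul_comm i m, ← mul_pow]
    norm_num
  have h4 : ((changeSets q m).card : ℝ) ≤ 2 ^ (m * i + 3 * q / 2 ^ (i + 1) + 1) := by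
    calc ((changeSets q m).card : ℝ)
        = ((changeSets q m).card : ℝ) * ((1 / 2 : ℝ) ^ i) ^ m * 2 ^ (m * i) := by
          rw [mul_assoc, h3, mul_one]
      _ ≤ 2 ^ (3 * q / 2 ^ (i + 1) + 1) * 2 ^ (m * i) := by
          gcongr
          exact h1.trans (one_add_inv_two_pow_pow_le q i)
      _ = _ := by rw [← pow_add]; congr 1; ring
  exact_mod_cast h4

/-! ### Indices and fractional charges -/

/-- The indices at which the vertices of a graph are placed: the root `inl none`, the special
vertices `inl (some (β, j))` with `j < t` for both halves `β`, and the ordinary vertices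
`inr ⟨β, p⟩`, where `p` is the position in the half `β`. -/
abbrev Idx (t : ℕ) (q : Bool → ℕ) : Type :=
  Option (Bool × Fin t) ⊕ (Σ β : Bool, Fin (q β))

/-- The pairs whose adjacency is told by the codebook element of the first index: a special vertex
and the ordinary vertices of its own half, or the root and the ordinary vertices of the half
`true`. -/
def Idx.Sorted {t : ℕ} {q : Bool → ℕ} : Idx t q → Idx t q → Prop
  | .inl none, .inr u => u.1 = true
  | .inl (some s), .inr u => u.1 = s.1
  | _, _ => False

/-- The fraction of a pair that is charged to its first index. Pairs of special vertices are charged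
to the root, or to the one with smaller `j`, which has the smaller codebook, or evenly if the `j`
are equal; pairs of a special and an ordinary vertex are charged according to `y₀` and `y`, and pairs of ordinary vertices almost evenly, tilted so that the
loads of the ordinary vertices differ as the numbers `b u` do. -/
noncomputable def Idx.share {t : ℕ} {q : Bool → ℕ} (y₀ : ℝ) (y : Bool → Fin t → ℝ)
    (b : (Σ β : Bool, Fin (q β)) → ℝ) : Idx t q → Idx t q → ℝ
  | .inl none, .inl none => 0
  | .inl none, .inl (some _) => 1
  | .inl (some _), .inl none => 0
  | .inl (some s), .inl (some s') =>
      (if s.2 < s'.2 then 1 else 0) + if s.2 = s'.2 ∧ s.1 ≠ s'.1 then 1 / 2 else 0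
  | .inl none, .inr u => if u.1 = false then y₀ else 0
  | .inr u, .inl none => if u.1 = false then 1 - y₀ else 0
  | .inl (some s), .inr u => if u.1 = s.1 then 0 else y s.1 s.2
  | .inr u, .inl (some s) => if u.1 = s.1 then 0 else 1 - y s.1 s.2
  | .inr u, .inr u' => if u = u' then 0 else
      1 / 2 + (b u - b u') / (q true + q false : ℕ)

/-- If the budgets `b u`, left to the ordinary vertices after paying for their pairs with special
vertices, suffice on average for the pairs of ordinary vertices and differ by at most half the
number of ordinary vertices, then all pairs not covered by codebooks can be stored. -/
theorem Idx.exists_slots {n t : ℕ} {q : Bool → ℕ} (e : Idx t q ≃ Fin n) (cap : Idx t q → ℕ)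
    (y₀ : ℝ) (y : Bool → Fin t → ℝ) (hy₀ : y₀ ∈ Set.Icc 0 1) (hy : ∀ β j, y β j ∈ Set.Icc 0 1)
    (h₀ : y₀ * q false + 2 * t ≤ cap (.inl none))
    (hs : ∀ β j, y β j * q (!β) + 2 * (t - 1 - (j : ℕ)) + 1 / 2 ≤ cap (.inl (some (β, j))))
    (b : (Σ β : Bool, Fin (q β)) → ℝ)
    (hb : ∀ u, b u = cap (.inr u) -
      (∑ j, (1 - y (!u.1) j) + if u.1 = false then 1 - y₀ else 0))
    (hsum : ((q true + q false : ℕ) : ℝ) * ((q true + q false : ℕ) - 1) / 2 ≤ ∑ u, b u)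
    (hdiff : ∀ u u', b u - b u' ≤ (q true + q false : ℕ) / 2) :
    ∃ r : Idx t q → Idx t q → Prop, (∀ i j, i ≠ j →
        Idx.Sorted i j ∨ Idx.Sorted j i ∨ r i j ∨ r j i) ∧
      ∃ φ : {p : Idx t q × Idx t q // r p.1 p.2} → (Σ u, Fin (cap u)),
        Function.Injective φ ∧ ∀ p, (φ p).1 = p.1.1 ∨ (φ p).1 = p.1.2 := by
  let r : Idx t q → Idx t q → Prop := fun i j => e i < e j ∧ ¬ Idx.Sorted i j ∧ ¬ Idx.Sorted j i
  refine ⟨r, ?_, exists_injective_slot r ?_ (Idx.share y₀ y b) ?_ ?_ cap ?_⟩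
  · intro i j hij
    have : e i ≠ e j := fun h => hij (e.injective h)
    rcases lt_or_gt_of_ne this with h | h <;> simp only [r] <;> tauto
  · rintro u x ⟨h, -⟩ ⟨h', -⟩
    exact lt_asymm h h'
  · have hv : ∀ u u', 0 ≤ 1 / 2 + (b u - b u') / ((q true + q false : ℕ) : ℝ) := by
      intro u u'
      rcases Nat.eq_zero_or_pos (q true + q false) with h | h
      · simp [h]
      · have h' : (0 : ℝ) < ((q true + q false : ℕ) : ℝ) := by exact_mod_cast h
        have h2 := hdiff u' u
        have : -(1 / 2) ≤ (b u - b u') / ((q true + q false : ℕ) : ℝ) := by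
          rw [le_div_iff₀ h']
          linarith
        linarith
    have h1 := hy₀.1
    have h2 := hy₀.2
    have h3 : ∀ s : Bool × Fin t, 0 ≤ y s.1 s.2 ∧ 0 ≤ 1 - y s.1 s.2 := fun s =>
      ⟨(hy s.1 s.2).1, sub_nonneg.2 (hy s.1 s.2).2⟩
    rintro ((_ | s) | u) ((_ | s') | u') <;> simp only [Idx.share]
    · exact le_rfl
    · exact zero_le_one
    · split_ifs <;> linarith
    · exact le_rfl
    · positivity
    · split_ifs
      exacts [le_rfl, (h3 s).1]
    · split_ifs <;> linarith
    · split_ifs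
      exacts [le_rfl, (h3 s').2]
    · split_ifs
      exacts [le_rfl, hv u u']
  · rintro i j ⟨hij, h1, h2⟩
    have hne : i ≠ j := by
      rintro rfl
      exact lt_irrefl _ hij
    rcases i with (_ | s) | u <;> rcases j with (_ | s') | u' <;>
      simp only [Idx.share, Idx.Sorted, Bool.not_eq_true, not_false_eq_true] at h1 h2 ⊢
    · exact absurd rfl hne
    · norm_num
    · simp [h1]
    · norm_num
    · have : s ≠ s' := by rintro rfl; exact hne rfl
      rcases lt_trichotomy s.2 s'.2 with h | h | h
      · rw [if_pos h, if_neg (not_lt.2 h.le), if_neg (fun h' => h.ne h'.1),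
          if_neg (fun h' => h.ne' h'.1)]
        norm_num
      · have h3 : s.1 ≠ s'.1 := fun h' => this (Prod.ext h' h)
        rw [if_neg (not_lt.2 h.ge), if_pos ⟨h, h3⟩, if_neg (not_lt.2 h.le),
          if_pos ⟨h.symm, h3.symm⟩]
        norm_num
      · rw [if_pos h, if_neg (not_lt.2 h.le), if_neg (fun h' => h.ne h'.1.symm),
          if_neg (fun h' => h.ne h'.1)]
        norm_num
    · rw [if_neg h1, if_neg h1]
      norm_num
    · simp [h2]
    · rw [if_neg h2, if_neg h2]
      norm_num
    · have : u ≠ u' := by rintro rfl; exact hne rfl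
      rw [if_neg this, if_neg this.symm, ← neg_sub (b u) (b u'), neg_div]
      linarith
  · rintro ((_ | s) | u)
    · rw [Fintype.sum_sum_type, Fintype.sum_option]
      simp only [Idx.share, Fintype.sum_sigma, Fintype.sum_bool]
      simp
      linarith
    · obtain ⟨β, j⟩ := s
      have h3 := hs β j
      have hIoi : (∑ x : Fin t, if j < x then (1 : ℝ) else 0) = t - 1 - (j : ℕ) := by
        rw [Finset.sum_boole]
        have : (Finset.univ.filter fun x => j < x) = Finset.Ioi j := by ext; simp
        have hj := j.2
        rw [this, Fin.card_Ioi, Nat.cast_sub (by omega : (j : ℕ) ≤ t - 1),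
          Nat.cast_sub (by omega : 1 ≤ t)]
        simp
      rw [Fintype.sum_sum_type, Fintype.sum_option]
      simp only [Idx.share, Fintype.sum_sigma, Fintype.sum_bool, Fintype.sum_prod_type,
        Finset.sum_add_distrib, hIoi]
      cases β <;> simp at h3 ⊢ <;> linarith
    · rw [Fintype.sum_sum_type, Fintype.sum_option]
      have h4 : ∑ x, Idx.share y₀ y b (.inr u) (.inr x) ≤ b u := by
        simp only [Idx.share]
        set v := q true + q false with hv
        have hcard : Fintype.card (Σ β : Bool, Fin (q β)) = v := by
          simp [Fintype.card_sigma, hv]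
        have hpos : 0 < v := by
          rw [← hcard]
          exact Fintype.card_pos_iff.2 ⟨u⟩
        have hpos' : (0 : ℝ) < v := by exact_mod_cast hpos
        have h5 : ∀ x, (if u = x then 0 else 1 / 2 + (b u - b x) / (v : ℝ)) =
            (1 / 2 + (b u - b x) / (v : ℝ)) - if u = x then 1 / 2 else 0 := by
          intro x
          split_ifs with h
          · subst h; simp
          · simp
        rw [Finset.sum_congr rfl fun x _ => h5 x, Finset.sum_sub_distrib, Finset.sum_add_distrib,
          ← Finset.sum_div, ← Finset.sum_div, Finset.sum_sub_distrib, Finset.sum_ite_eq]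
        simp only [Finset.sum_const, Finset.card_univ, hcard, nsmul_eq_mul, Finset.mem_univ,
          if_true]
        have h6 : (v * b u - ∑ x, b x) / v ≤ b u - (v - 1) / 2 := by
          rw [div_le_iff₀ hpos']
          linarith
        linarith
      have h7 : ∑ s, Idx.share y₀ y b (.inr u) (.inl (some s)) = ∑ j, (1 - y (!u.1) j) := by
        simp only [Idx.share, Fintype.sum_prod_type, Fintype.sum_bool]
        obtain ⟨β, i⟩ := u
        cases β <;> simp
      have h8 : Idx.share y₀ y b (.inr u) (.inl none) = if u.1 = false then 1 - y₀ else 0 := rfl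
      have := hb u
      linarith

/-! ### Placing the vertices of a graph -/

/-- The half `true` can be filled from the larger of the two classes of a property. -/
theorem exists_perm_const_on_half {q : Bool → ℕ} (hq : q true ≤ q false + 1)
    (X : (Σ β : Bool, Fin (q β)) → Prop) :
    ∃ (ρ : Equiv.Perm (Σ β : Bool, Fin (q β))) (c : Prop), ∀ i, X (ρ ⟨true, i⟩) ↔ c := by
  classical
  have hcard : Fintype.card (Σ β : Bool, Fin (q β)) = q true + q false := by
    simp [Fintype.card_sigma]
  obtain ⟨c, hc⟩ : ∃ c : Prop, q true ≤ (Finset.univ.filter fun u => X u ↔ c).card := by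
    by_contra! h
    have h1 : (Finset.univ.filter fun u => X u).card < q true := by simpa using h True
    have h2 : (Finset.univ.filter fun u => ¬ X u).card < q true := by simpa using h False
    have h3 : (Finset.univ.filter fun u => X u).card + (Finset.univ.filter fun u => ¬ X u).card =
        q true + q false := by
      rw [← hcard, ← Finset.card_univ]
      convert Finset.card_filter_add_card_filter_not (s := Finset.univ) X
    omega
  obtain ⟨M, hM, hMc⟩ := Finset.exists_subset_card_eq hc
  have hT : Fintype.card {u : Σ β : Bool, Fin (q β) // u.1 = true} = Fintype.card {u // u ∈ M} := by
    rw [Fintype.card_coe, hMc]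
    rw [← Fintype.card_fin (q true)]
    exact (Fintype.card_congr
      { toFun := fun i => ⟨⟨true, i⟩, rfl⟩
        invFun := fun u => u.2 ▸ u.1.2
        left_inv := fun i => rfl
        right_inv := by
          rintro ⟨⟨β, i⟩, h⟩
          obtain rfl : β = true := h
          rfl }).symm
  let ε := Fintype.equivOfCardEq hT
  refine ⟨ε.extendSubtype, c, fun i => ?_⟩
  have h := ε.extendSubtype_mem ⟨true, i⟩ rfl
  exact (Finset.mem_filter.1 (hM h)).2

/-- The position of an ordinary vertex in its half; for special vertices the value is irrelevant. -/
def Idx.pos {t : ℕ} {q : Bool → ℕ} : Idx t q → ℕ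
  | .inl _ => 0
  | .inr u => u.2

/-- The codebook of an index. A set `D` of positions stands for the column which is true at `p` if
`D` has an odd number of elements up to `p`. The root has the two constant columns; the special
vertex number `j` of half `β` has the columns of length `q β` with at most `2 ^ j` changes. -/
def Idx.code {t : ℕ} {q : Bool → ℕ} : Idx t q → Finset (Finset ℕ)
  | .inl none => {∅, {0}}
  | .inl (some s) => changeSets (q s.1) (2 ^ (s.2 : ℕ))
  | .inr _ => {∅}

theorem Idx.exists_arrangement {n t : ℕ} {q : Bool → ℕ} (hq : q true ≤ q false + 1)
    (e : Idx t q ≃ Fin n) (G : SimpleGraph (Fin n)) :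
    ∃ σ : Idx t q ≃ Fin n, ∀ i, ∃ D ∈ Idx.code i, ∀ j, Idx.Sorted i j →
      (G.Adj (σ i) (σ j) ↔ Odd (D.filter (· ≤ Idx.pos j)).card) := by
  classical
  obtain ⟨ρ, c, hρ⟩ := exists_perm_const_on_half hq
    fun u => G.Adj (e (.inl none)) (e (.inr u))
  let x : ∀ β, ℕ → Fin (q β) → Bool := fun β j p =>
    if h : j < t then decide (G.Adj (e (.inl (some (β, ⟨j, h⟩)))) (e (.inr (ρ ⟨β, p⟩)))) else false
  choose τ hτ using fun β => exists_perm_odd_monotone (x β) t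
  refine ⟨(Equiv.sumCongr (Equiv.refl _) ((Equiv.sigmaCongrRight τ).trans ρ)).trans e, ?_⟩
  rintro ((_ | ⟨β, j⟩) | u)
  · refine ⟨if c then {0} else ∅, ?_, ?_⟩
    · split_ifs <;> simp [Idx.code]
    · rintro (s | ⟨β, p⟩) h
      · exact h.elim
      · obtain rfl : β = true := h
        have := hρ (τ true p)
        simp only [Equiv.trans_apply, Equiv.sumCongr_apply, Sum.map_inl, Sum.map_inr,
          Equiv.refl_apply, Equiv.sigmaCongrRight_apply] at this ⊢
        refine this.trans ?_
        split_ifs with hc <;> simp [hc]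
        rw [Finset.filter_true_of_mem (by simp)]
        simp
  · obtain ⟨F, hF, hF2, hFx⟩ := hτ β j j.2
    obtain ⟨D, hD, hDF⟩ := exists_mem_changeSets hF hF2
    refine ⟨D, hD, ?_⟩
    rintro (s | ⟨β', p⟩) h
    · exact h.elim
    · obtain rfl : β' = β := h
      rw [Idx.pos, ← hDF, ← hFx]
      simp [x]
  · exact ⟨∅, by simp [Idx.code], fun j h => h.elim⟩

/-! ### Counting bits -/

/-- A number of bits that suffices for a column of length `q` with at most `2 ^ j` changes; it is
the bound of `card_changeSets_le` for `i = t + 2 - j`. That choice of `i` is near the optimum when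
`q` is about `2 ^ (t + 2)`, and good enough down to half of that. -/
def codeLength (q t j : ℕ) : ℕ := 2 ^ j * (t + 2 - j) + 3 * q / 2 ^ (t + 2 - j + 1) + 1

theorem sum_two_pow_mul (t : ℕ) :
    ∑ j ∈ Finset.range t, (2 : ℝ) ^ j * (t + 2 - j) = 2 ^ (t + 2) - t - 4 := by
  induction t with
  | zero => norm_num
  | succ t ih =>
    have h : ∑ j ∈ Finset.range t, (2 : ℝ) ^ j * (((t + 1 : ℕ) : ℝ) + 2 - j) =
        ∑ j ∈ Finset.range t, (2 : ℝ) ^ j * (t + 2 - j) + ∑ j ∈ Finset.range t, (2 : ℝ) ^ j := by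
      rw [← Finset.sum_add_distrib]
      refine Finset.sum_congr rfl fun j _ => ?_
      push_cast
      ring
    rw [Finset.sum_range_succ, h, ih, geom_sum_eq (by norm_num)]
    push_cast
    ring

theorem sum_codeLength_le (q t : ℕ) :
    ∑ j : Fin t, (codeLength q t j : ℝ) ≤ 2 ^ (t + 2) - 4 + 3 * q / 8 := by
  rw [Fin.sum_univ_eq_sum_range (fun j => (codeLength q t j : ℝ)) t]
  have h : ∀ j ∈ Finset.range t, (codeLength q t j : ℝ) ≤
      2 ^ j * (t + 2 - j) + 3 * q / 2 ^ (t + 3) * 2 ^ j + 1 := by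
    intro j hj
    have hj : j < t := Finset.mem_range.1 hj
    have h1 : ((3 * q / 2 ^ (t + 2 - j + 1) : ℕ) : ℝ) ≤ 3 * q / 2 ^ (t + 3) * 2 ^ j := by
      refine (Nat.cast_div_le).trans (le_of_eq ?_)
      have : (2 : ℝ) ^ (t + 3) = 2 ^ (t + 2 - j + 1) * 2 ^ j := by
        rw [← pow_add]
        congr 1
        omega
      rw [this]
      push_cast
      field_simp
    have h2 : ((2 ^ j * (t + 2 - j) : ℕ) : ℝ) = 2 ^ j * (t + 2 - j) := by
      rw [Nat.cast_mul, Nat.cast_sub (by omega)]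
      push_cast
      ring
    rw [codeLength, Nat.cast_add, Nat.cast_add, h2, Nat.cast_one]
    linarith
  refine (Finset.sum_le_sum h).trans ?_
  rw [Finset.sum_add_distrib, Finset.sum_add_distrib, sum_two_pow_mul, ← Finset.mul_sum,
    geom_sum_eq (by norm_num)]
  have h3 : (3 * q / 2 ^ (t + 3) * ((2 ^ t - 1) / (2 - 1)) : ℝ) ≤ 3 * q / 8 := by
    have h4 : (3 * q / 8 : ℝ) = 3 * q / 2 ^ (t + 3) * 2 ^ t := by
      rw [pow_add]
      field_simp
      norm_num
    rw [h4]
    gcongr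
    norm_num
  simp only [Finset.sum_const, Finset.card_range, nsmul_eq_mul, mul_one]
  linarith

theorem codeLength_add_le {q t j : ℕ} (hj : j < t) :
    codeLength q t j + 2 * (t - 1 - j) ≤ 3 * 2 ^ (t - 1) + 3 * q / 16 + 1 := by
  obtain ⟨s, rfl⟩ : ∃ s, t = j + 1 + s := ⟨t - (j + 1), by omega⟩
  have h1 : j + 1 + s - 1 - j = s := by omega
  have h2 : j + 1 + s + 2 - j = s + 3 := by omega
  have h3 : j + 1 + s - 1 = j + s := by omega
  rw [codeLength, h1, h2, h3]
  have h4 : 3 * q / 2 ^ (s + 3 + 1) ≤ 3 * q / 16 := by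
    apply Nat.div_le_div_left _ (by norm_num)
    calc 16 = 2 ^ 4 := by norm_num
      _ ≤ 2 ^ (s + 3 + 1) := Nat.pow_le_pow_right (by norm_num) (by omega)
  have h5 : s + 1 ≤ 2 ^ s := Nat.lt_two_pow_self
  have h6 : 1 ≤ 2 ^ j := Nat.one_le_two_pow
  have h7 : 2 ^ j * (s + 3) + 2 * s ≤ 3 * (2 ^ j * 2 ^ s) := by
    calc 2 ^ j * (s + 3) + 2 * s ≤ 2 ^ j * (s + 3) + 2 ^ j * (2 * s) := by
          exact Nat.add_le_add_left (Nat.le_mul_of_pos_left _ h6) _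
      _ = 3 * (2 ^ j * (s + 1)) := by ring
      _ ≤ _ := by gcongr
  rw [← pow_add] at h7
  omega

/-- The ordinary vertices can afford the pairs among themselves. Here `S` is the total length of the
codes of the special vertices, `P = 2 ^ (t + 3)`, and `e` is the number of ordinary vertices with
an additional bit. After cancellation the slack is at least about `5 / 8 * n - 2 * t ^ 2`. -/
theorem budget_inequality {n t c a v e P S : ℝ} (hv : v = n - 2 * t - 1) (ha : a ≤ (v + 1) / 2)
    (hc : n / 2 + 1 - t ≤ c) (hS : S ≤ P - 8 + 3 * v / 8) (he : P - n ≤ e ∨ v ≤ e)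
    (hP : P ≤ 2 * n - 2) (hn : 5 * t ^ 2 ≤ n) (ht : 4 ≤ t) :
    v * (v - 1) / 2 ≤ v * c + e -
      (t * v - 2 * t * c + S + (2 * t * (t - 1) + t) + a - (c - 1 - 2 * t)) := by
  have h0 : 0 ≤ n := by nlinarith
  have h1 : 0 ≤ n * (c - (n / 2 + 1 - t)) := mul_nonneg h0 (by linarith)
  subst hv
  rcases he with h | h <;> nlinarith

theorem five_mul_sq_le {t n : ℕ} (hn : 100 ≤ n) (h : 2 ^ (t + 2) < n) : 5 * t ^ 2 ≤ n := by
  rcases Nat.lt_or_ge t 5 with ht | ht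
  · have : t ^ 2 ≤ 4 ^ 2 := Nat.pow_le_pow_left (by omega) 2
    omega
  · refine le_trans ?_ h.le
    clear h hn
    induction t, ht using Nat.le_induction with
    | base => norm_num
    | succ k hk ih =>
      have : (2 : ℕ) ^ (k + 1 + 2) = 2 * 2 ^ (k + 2) := by ring
      rw [this]
      nlinarith

/-- The longest code, with `j = t - 1`, leaves room in the label of a special vertex. -/
theorem room_inequality {n t L q : ℕ} (hn : 100 ≤ n) (h1 : 2 ^ (t + 2) < n) (h2 : n ≤ 2 ^ (t + 3))
    (hL : n + 8 ≤ 2 * L) (hq : 2 * q ≤ n - 2 * t) :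
    3 * 2 ^ (t - 1) + 3 * q / 16 + 1 + 1 ≤ L - (t + 3) := by
  have h4 : 4 ≤ t := by
    by_contra! h
    have : 2 ^ (t + 3) ≤ 2 ^ 6 := Nat.pow_le_pow_right (by norm_num) (by omega)
    omega
  rcases Nat.lt_or_ge t 6 with h | h
  · interval_cases t <;> norm_num at h1 h2 ⊢ <;> omega
  · obtain ⟨s, rfl⟩ : ∃ s, t = s + 1 := ⟨t - 1, by omega⟩
    have h5 : 4 * (s + 1) + 8 ≤ 2 ^ s := by
      have : 5 ≤ s := by omega
      clear h h1 h2 hL hq h4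
      induction s, this using Nat.le_induction with
      | base => norm_num
      | succ k hk ih => rw [pow_succ]; omega
    have h6 : 2 ^ (s + 1 + 2) = 8 * 2 ^ s := by rw [add_assoc, pow_add]; norm_num; ring
    rw [h6] at h1
    rw [Nat.add_sub_cancel]
    generalize 2 ^ s = M at *
    omega

/-! ### The choice of parameters -/

open Classical in
/-- The scheme with `2 * t + 1` special vertices, where `2 ^ (t + 2) < n ≤ 2 ^ (t + 3)`. With
`c = L - (t + 3)`, every index may use `2 ^ c` labels and `2 ^ (t + 3) - n` such quotas are left
over; they give ordinary vertices one further bit each. -/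
theorem exists_scheme_of_two_pow_bounds {n t L : ℕ} (hn : 100 ≤ n) (hlo : 2 ^ (t + 2) < n)
    (hhi : n ≤ 2 ^ (t + 3)) (hL : n + 8 ≤ 2 * L) (hL' : 2 * L ≤ n + 9) :
    ∃ S : AdjacencyLabelingScheme (Set.univ : Set (SimpleGraph (Fin n))) L,
      S.Distinct ∧ S.Indexing := by
  have ht : 4 ≤ t := by
    by_contra! h
    have : 2 ^ (t + 3) ≤ 2 ^ 6 := Nat.pow_le_pow_right (by norm_num) (by omega)
    omega
  have htn := five_mul_sq_le hn hlo
  have htn' : 20 * t ≤ n := by nlinarith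
  obtain ⟨v, hv⟩ : ∃ v, v = n - 2 * t - 1 := ⟨_, rfl⟩
  let q : Bool → ℕ := fun β => if β then v / 2 else v - v / 2
  have hqt : q true = v / 2 := rfl
  have hqf : q false = v - v / 2 := rfl
  have hqv : q true + q false = v := by omega
  have hqle : ∀ β, 2 * q β ≤ n - 2 * t := by rintro (_ | _) <;> omega
  have hqge : ∀ β, n - 2 * t - 2 ≤ 2 * q β := by rintro (_ | _) <;> omega
  have hqpos : ∀ β, 0 < q β := fun β => by have := hqge β; omega
  obtain ⟨c, hc⟩ : ∃ c, c = L - (t + 3) := ⟨_, rfl⟩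
  have hX : ∀ β, ∀ j < t, codeLength (q β) t j + 2 * (t - 1 - j) + 1 ≤ c := by
    intro β j hj
    have h1 := codeLength_add_le (q := q β) hj
    have h2 := room_inequality hn hlo hhi hL (hqle β)
    omega
  have hX2 : ∀ β, ∀ j < t, 2 ≤ codeLength (q β) t j := by
    intro β j hj
    have : 1 ≤ 2 ^ j * (t + 2 - j) := Nat.mul_pos (by positivity) (by omega)
    exact Nat.succ_le_succ (this.trans (Nat.le_add_right _ _))
  have hVcard : Fintype.card (Σ β : Bool, Fin (q β)) = v := by
    simp [Fintype.card_sigma, hqv]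
  obtain ⟨R, -, hR⟩ := Finset.exists_subset_card_eq
    (s := (Finset.univ : Finset (Σ β : Bool, Fin (q β)))) (n := min (2 ^ (t + 3) - n) v)
    (by rw [Finset.card_univ, hVcard]; exact min_le_right _ _)
  -- The root keeps one bit for its codebook of two columns.
  let cap : Idx t q → ℕ
    | .inl none => c - 1
    | .inl (some s) => c - codeLength (q s.1) t s.2
    | .inr u => c + if u ∈ R then 1 else 0
  have hIcard : Fintype.card (Idx t q) = n := by
    rw [Fintype.card_sum, hVcard, Fintype.card_option, Fintype.card_prod, Fintype.card_bool,
      Fintype.card_fin]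
    omega
  let e : Idx t q ≃ Fin n := Fintype.equivFinOfCardEq hIcard
  have hkraft : ∑ i : Idx t q, (Idx.code i).card * 2 ^ cap i ≤ 2 ^ L := by
    have h1 : ∀ s : Option (Bool × Fin t),
        (Idx.code (.inl s : Idx t q)).card * 2 ^ cap (.inl s) ≤ 2 ^ c := by
      rintro (_ | ⟨β, j⟩)
      · have := hX true 0 (by omega)
        calc (Idx.code (.inl none : Idx t q)).card * 2 ^ (c - 1) ≤ 2 * 2 ^ (c - 1) := by
              gcongr
              exact Finset.card_le_two
          _ = 2 ^ c := by rw [← pow_succ']; congr 1; omega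
      · have := hX β j j.2
        calc (changeSets (q β) (2 ^ (j : ℕ))).card * 2 ^ (c - codeLength (q β) t j)
            ≤ 2 ^ codeLength (q β) t j * 2 ^ (c - codeLength (q β) t j) := by
              gcongr
              exact card_changeSets_le _ _ _
          _ = 2 ^ c := by rw [← pow_add]; congr 1; omega
    have h2 : ∀ u : (Σ β : Bool, Fin (q β)),
        (Idx.code (.inr u : Idx t q)).card * 2 ^ cap (.inr u) =
          2 ^ c * (1 + if u ∈ R then 1 else 0) := by
      intro u
      simp only [Idx.code, cap, Finset.card_singleton, one_mul]
      split_ifs <;> ring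
    rw [Fintype.sum_sum_type]
    calc _ ≤ ∑ s : Option (Bool × Fin t), 2 ^ c +
          ∑ u : (Σ β : Bool, Fin (q β)), 2 ^ c * (1 + if u ∈ R then 1 else 0) :=
          add_le_add (Finset.sum_le_sum fun s _ => h1 s)
            (le_of_eq (Finset.sum_congr rfl fun u _ => h2 u))
      _ = 2 ^ c * ((2 * t + 1) + (v + R.card)) := by
          rw [← Finset.mul_sum, Finset.sum_add_distrib]
          simp [hVcard]
          ring
      _ ≤ 2 ^ c * 2 ^ (t + 3) := by
          gcongr
          omega
      _ = 2 ^ L := by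
          rw [← pow_add]
          congr 1
          omega
  -- Each special vertex pays for its pairs with the other special vertices, and spends all that is
  -- left of its bits evenly on the ordinary vertices of the half that it does not sort.
  let y₀ : ℝ := (c - 1 - 2 * t) / q false
  let y : Bool → Fin t → ℝ := fun β j =>
    (c - codeLength (q β) t j - 2 * (t - 1 - (j : ℕ)) - 1 / 2) / q (!β)
  have hqR : ∀ β, (0 : ℝ) < q β := fun β => by exact_mod_cast hqpos β
  have hqgeR : ∀ β, (n : ℝ) - 2 * t - 2 ≤ 2 * q β := fun β => by
    have := hqge β
    have h : n ≤ 2 * q β + 2 * t + 2 := by omega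
    have : (n : ℝ) ≤ 2 * q β + 2 * t + 2 := by exact_mod_cast h
    linarith
  have hcle : 2 * (c : ℝ) ≤ n + 3 - 2 * t := by
    have h : 2 * c + 2 * t ≤ n + 3 := by omega
    have : 2 * (c : ℝ) + 2 * t ≤ n + 3 := by exact_mod_cast h
    linarith
  have hcge : (n : ℝ) / 2 + 1 - t ≤ c := by
    have h : n + 2 ≤ 2 * c + 2 * t := by omega
    have : (n : ℝ) + 2 ≤ 2 * c + 2 * t := by exact_mod_cast h
    linarith
  have htR : (4 : ℝ) ≤ t := by exact_mod_cast ht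
  have htnR : 20 * (t : ℝ) ≤ n := by exact_mod_cast htn'
  have hXR : ∀ β (j : Fin t),
      (codeLength (q β) t j : ℝ) + 2 * (t - 1 - (j : ℕ)) + 1 ≤ c := by
    intro β j
    have h : codeLength (q β) t j + 2 * t ≤ c + 2 * (j : ℕ) + 1 := by
      have := hX β j j.2
      have := j.2
      omega
    have : (codeLength (q β) t j : ℝ) + 2 * t ≤ c + 2 * (j : ℕ) + 1 := by exact_mod_cast h
    linarith
  have hy₀ : y₀ ∈ Set.Icc (0 : ℝ) 1 := by
    have := hqgeR false
    constructor
    · exact div_nonneg (by linarith) (hqR false).le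
    · rw [div_le_one (hqR false)]
      linarith
  have hy : ∀ β j, y β j ∈ Set.Icc (0 : ℝ) 1 := by
    intro β j
    have h1 := hqgeR (!β)
    have h2 := hXR β j
    have h3 : (2 : ℝ) ≤ codeLength (q β) t j := by exact_mod_cast hX2 β j j.2
    have h4 : ((j : ℕ) : ℝ) + 1 ≤ t := by exact_mod_cast j.2
    constructor
    · exact div_nonneg (by linarith) (hqR _).le
    · rw [div_le_one (hqR _)]
      linarith
  -- What an ordinary vertex of half `β` pays for its pairs with special vertices.
  let d : Bool → ℝ := fun β => ∑ j, (1 - y (!β) j) + if β = false then 1 - y₀ else 0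
  have hd0 : ∀ β, 0 ≤ d β := by
    intro β
    refine add_nonneg (Finset.sum_nonneg fun j _ => sub_nonneg.2 (hy _ j).2) ?_
    split_ifs
    exacts [sub_nonneg.2 hy₀.2, le_rfl]
  have hd1 : ∀ β, d β ≤ t + 1 := by
    intro β
    refine add_le_add ?_ ?_
    · refine (Finset.sum_le_sum (g := fun _ => (1 : ℝ)) fun j _ => ?_).trans (by simp)
      linarith [(hy (!β) j).1]
    · split_ifs <;> linarith [hy₀.1]
  let b : (Σ β : Bool, Fin (q β)) → ℝ := fun u => cap (.inr u) - d u.1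
  have hqd : ∀ β, q β * d β = t * q β - (t * c - ∑ j : Fin t, (codeLength (q (!β)) t j : ℝ)
      - t * (t - 1) - t / 2) + if β = false then (q false : ℝ) - (c - 1 - 2 * t) else 0 := by
    intro β
    have h1 : ∀ j, q β * (1 - y (!β) j) =
        q β - (c - codeLength (q (!β)) t j - 2 * (t - 1 - (j : ℕ)) - 1 / 2) := by
      intro j
      have := (hqR β).ne'
      simp only [y, Bool.not_not]
      field_simp
    have h2 : (q false : ℝ) * (1 - y₀) = q false - (c - 1 - 2 * t) := by
      have := (hqR false).ne'
      simp only [y₀]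
      field_simp
    have h3 : ∑ j : Fin t, ((j : ℕ) : ℝ) = t * (t - 1) / 2 := by
      rw [Fin.sum_univ_eq_sum_range (fun j => (j : ℝ)) t]
      clear * -
      induction t with
      | zero => simp
      | succ k ih => rw [Finset.sum_range_succ, ih]; push_cast; ring
    simp only [d]
    rw [mul_add, Finset.mul_sum, Finset.sum_congr rfl fun j _ => h1 j]
    congr 1
    · simp only [Finset.sum_sub_distrib, ← Finset.mul_sum, h3, Finset.sum_const, Finset.card_univ,
        Fintype.card_fin, nsmul_eq_mul]
      ring
    · split_ifs with h
      · rw [h, h2]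
      · simp
  have hsumb : ∑ u, b u = v * c + R.card - (q true * d true + q false * d false) := by
    simp only [b, cap, Nat.cast_add, Finset.sum_sub_distrib, Finset.sum_add_distrib]
    congr 1
    · simp [hVcard]
    · rw [Fintype.sum_sigma, Fintype.sum_bool]
      simp
  have hvR : (v : ℝ) = n - 2 * t - 1 := by
    have h : v + 2 * t + 1 = n := by omega
    have : (v : ℝ) + 2 * t + 1 = n := by exact_mod_cast h
    linarith
  have hqvR : (q true : ℝ) + q false = v := by exact_mod_cast hqv
  have hsum : ((q true + q false : ℕ) : ℝ) * ((q true + q false : ℕ) - 1) / 2 ≤ ∑ u, b u := by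
    rw [hqv, hsumb, hqd, hqd]
    have hS1 := sum_codeLength_le (q true) t
    have hS2 := sum_codeLength_le (q false) t
    have ha : (q false : ℝ) ≤ (v + 1) / 2 := by
      have h : 2 * q false ≤ v + 1 := by omega
      have : 2 * (q false : ℝ) ≤ v + 1 := by exact_mod_cast h
      linarith
    have hP : (2 : ℝ) ^ (t + 3) ≤ 2 * n - 2 := by
      have h : 2 ^ (t + 3) + 2 ≤ 2 * n := by
        have : 2 ^ (t + 3) = 2 * 2 ^ (t + 2) := by ring
        omega
      have : (2 : ℝ) ^ (t + 3) + 2 ≤ 2 * n := by exact_mod_cast h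
      linarith
    have hR' : (2 : ℝ) ^ (t + 3) - n ≤ R.card ∨ (v : ℝ) ≤ R.card := by
      rw [hR]
      rcases le_total (2 ^ (t + 3) - n) v with h | h
      · left
        rw [min_eq_left h, Nat.cast_sub hhi]
        simp
      · right
        rw [min_eq_right h]
    have hp : (2 : ℝ) ^ (t + 3) = 2 * 2 ^ (t + 2) := by ring
    have key := budget_inequality (n := n) (t := t) (c := c) (a := q false) (v := v) (e := R.card)
      (P := 2 ^ (t + 3)) (S := ∑ j : Fin t, (codeLength (q true) t j : ℝ) +
        ∑ j : Fin t, (codeLength (q false) t j : ℝ)) hvR ha hcge (by rw [hp]; linarith) hR' hP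
      (by exact_mod_cast htn) htR
    have h4 : (t : ℝ) * q true + t * q false = t * v := by rw [← mul_add, hqvR]
    simp only [Bool.not_true, Bool.not_false, Bool.true_eq_false, if_false, if_true]
    linarith
  have hdiff : ∀ u u', b u - b u' ≤ ((q true + q false : ℕ) : ℝ) / 2 := by
    intro u u'
    have h1 : (cap (.inr u) : ℝ) ≤ c + 1 := by
      have : cap (.inr u) ≤ c + 1 := by simp only [cap]; split_ifs <;> omega
      exact_mod_cast this
    have h2 : (c : ℝ) ≤ cap (.inr u') := by
      have : c ≤ cap (.inr u') := by simp only [cap]; omega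
      exact_mod_cast this
    have h3 := hd0 u.1
    have h4 := hd1 u'.1
    rw [hqv, hvR]
    simp only [b]
    linarith
  obtain ⟨r, hcover, φ, hφ, hends⟩ := Idx.exists_slots e cap y₀ y hy₀ hy
    (by
      have := (hqR false).ne'
      have h1 : 1 ≤ c := by have := hX true 0 (by omega); omega
      simp only [y₀, cap, Nat.cast_sub h1]
      field_simp
      simp)
    (by
      intro β j
      have h1 := (hqR (!β)).ne'
      have h2 : codeLength (q β) t j ≤ c := by have := hX β j j.2; omega
      simp only [y, cap, Nat.cast_sub h2]
      rw [div_mul_cancel₀ _ h1]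
      linarith)
    b (fun u => rfl) hsum hdiff
  exact exists_scheme_of_codebooks (by omega) e Idx.Sorted Idx.code
    (fun _ D j => Odd (D.filter (· ≤ Idx.pos j)).card) cap r φ hφ hends hcover hkraft
    fun G => by
      obtain ⟨σ, hσ⟩ := Idx.exists_arrangement (by omega) e G
      refine ⟨σ, fun i => ?_⟩
      obtain ⟨D, hD, h⟩ := hσ i
      refine ⟨D, hD, fun j hj => (h j hj).trans ?_⟩
      convert Iff.rfl

theorem exists_scheme {n L : ℕ} (hn : 100 ≤ n) (hL : n + 8 ≤ 2 * L) (hL' : 2 * L ≤ n + 9) :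
    ∃ S : AdjacencyLabelingScheme (Set.univ : Set (SimpleGraph (Fin n))) L,
      S.Distinct ∧ S.Indexing := by
  have h1 : 6 < Nat.clog 2 n := (Nat.lt_clog_iff_pow_lt (by norm_num)).2 (by omega)
  have h2 : n ≤ 2 ^ Nat.clog 2 n := Nat.le_pow_clog (by norm_num) n
  have h3 : 2 ^ (Nat.clog 2 n - 1) < n := Nat.pow_pred_clog_lt_self (by norm_num) (by omega)
  obtain ⟨t, ht⟩ : ∃ t, Nat.clog 2 n = t + 3 := ⟨Nat.clog 2 n - 3, by omega⟩
  rw [ht] at h2 h3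
  exact exists_scheme_of_two_pow_bounds hn h3 h2 hL hL'

/-! ### Induced-universal graphs -/

/-- The decoder is the adjacency of a graph on all bit strings; distinctness makes the labels of a
graph an embedding into it. -/
theorem AdjacencyLabelingScheme.Distinct.exists_isInducedUniversal {n L : ℕ}
    {F : Set (SimpleGraph (Fin n))} {S : AdjacencyLabelingScheme F L} (hS : S.Distinct) :
    ∃ U : SimpleGraph (Fin (2 ^ L)), IsInducedUniversal U F := by
  let e : (Fin L → Bool) ≃ Fin (2 ^ L) := Fintype.equivFinOfCardEq (by simp)
  refine ⟨{
    Adj := fun x y => x ≠ y ∧ S.edge (e.symm x) (e.symm y) = true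
    symm := ⟨fun x y h => ⟨h.1.symm, S.edge_symm _ _ ▸ h.2⟩⟩
    loopless := ⟨fun x h => h.1 rfl⟩ }, fun G hG => ⟨⟨⟨fun u => e (S.label ⟨G, hG⟩ u), ?_⟩, ?_⟩⟩⟩
  · intro u v h
    by_contra huv
    exact hS ⟨G, hG⟩ u v huv (e.injective h)
  · intro u v
    have h := S.adj_iff ⟨G, hG⟩ u v
    change (e (S.label ⟨G, hG⟩ u) ≠ e (S.label ⟨G, hG⟩ v) ∧
      S.edge (e.symm (e (S.label ⟨G, hG⟩ u))) (e.symm (e (S.label ⟨G, hG⟩ v))) = true) ↔ G.Adj u v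
    rw [Equiv.symm_apply_apply, Equiv.symm_apply_apply, ← h]
    exact ⟨fun h' => h'.2, fun ha =>
      ⟨fun h' => hS ⟨G, hG⟩ u v (G.ne_of_adj ha) (e.injective h'), ha⟩⟩

/-- The disjoint union of all graphs on `n` vertices is induced-universal. -/
theorem exists_isInducedUniversal (n : ℕ) (F : Set (SimpleGraph (Fin n))) :
    ∃ (N : ℕ) (U : SimpleGraph (Fin N)), IsInducedUniversal U F := by
  classical
  let e : SimpleGraph (Fin n) × Fin n ≃ Fin (Fintype.card (SimpleGraph (Fin n) × Fin n)) :=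
    Fintype.equivFin _
  refine ⟨_, {
    Adj := fun x y => (e.symm x).1 = (e.symm y).1 ∧ (e.symm x).1.Adj (e.symm x).2 (e.symm y).2
    symm := ⟨fun x y h => ⟨h.1.symm, h.1 ▸ h.2.symm⟩⟩
    loopless := ⟨fun x h => h.2.ne rfl⟩ }, fun G _ => ⟨⟨⟨fun u => e (G, u), ?_⟩, ?_⟩⟩⟩
  · intro u v h
    exact congrArg Prod.snd (e.injective h)
  · intro u v
    change ((e.symm (e (G, u))).1 = (e.symm (e (G, v))).1 ∧
      (e.symm (e (G, u))).1.Adj (e.symm (e (G, u))).2 (e.symm (e (G, v))).2) ↔ G.Adj u v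
    simp

theorem mainTheorem1 :
    (∀ n : ℕ, 100 ≤ n →
      ∃ S : AdjacencyLabelingScheme (Set.univ : Set (SimpleGraph (Fin n))) (⌈(n : ℝ) / 2⌉₊ + 4),
        S.Distinct ∧ S.Indexing) ∧
    (∃ N : ℕ → ℕ,
      (fun n : ℕ => (N n : ℝ)) =O[atTop] (fun n : ℕ => (2 : ℝ) ^ ((n : ℝ) / 2)) ∧
      ∀ n : ℕ, ∃ U : SimpleGraph (Fin (N n)),
        IsInducedUniversal U (Set.univ : Set (SimpleGraph (Fin n)))) := by
  have hscheme : ∀ n : ℕ, 100 ≤ n →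
      ∃ S : AdjacencyLabelingScheme (Set.univ : Set (SimpleGraph (Fin n))) (⌈(n : ℝ) / 2⌉₊ + 4),
        S.Distinct ∧ S.Indexing := by
    intro n hn
    have h1 := Nat.le_ceil ((n : ℝ) / 2)
    have h2 := Nat.ceil_lt_add_one (a := (n : ℝ) / 2) (by positivity)
    have h3 : n ≤ 2 * ⌈(n : ℝ) / 2⌉₊ := by
      have : (n : ℝ) ≤ 2 * ⌈(n : ℝ) / 2⌉₊ := by linarith
      exact_mod_cast this
    have h4 : 2 * ⌈(n : ℝ) / 2⌉₊ < n + 2 := by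
      have : 2 * (⌈(n : ℝ) / 2⌉₊ : ℝ) < n + 2 := by linarith
      exact_mod_cast this
    exact exists_scheme hn (by omega) (by omega)
  refine ⟨hscheme, ?_⟩
  have hU : ∀ n : ℕ, ∃ N : ℕ, (100 ≤ n → N = 2 ^ (⌈(n : ℝ) / 2⌉₊ + 4)) ∧
      ∃ U : SimpleGraph (Fin N), IsInducedUniversal U (Set.univ : Set (SimpleGraph (Fin n))) := by
    intro n
    by_cases hn : 100 ≤ n
    · obtain ⟨S, hS, -⟩ := hscheme n hn
      exact ⟨_, fun _ => rfl, hS.exists_isInducedUniversal⟩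
    · obtain ⟨N, U, h⟩ := exists_isInducedUniversal n Set.univ
      exact ⟨N, fun h' => absurd h' hn, U, h⟩
  choose N hN hNU using hU
  refine ⟨N, IsBigO.of_bound 32 ?_, hNU⟩
  filter_upwards [eventually_ge_atTop 100] with n hn
  have h2 := Nat.ceil_lt_add_one (a := (n : ℝ) / 2) (by positivity)
  rw [hN n hn, Real.norm_of_nonneg (by positivity), Real.norm_of_nonneg (by positivity)]
  calc ((2 ^ (⌈(n : ℝ) / 2⌉₊ + 4) : ℕ) : ℝ) = (2 : ℝ) ^ ((⌈(n : ℝ) / 2⌉₊ : ℝ) + 4) := by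
        push_cast
        rw [← Real.rpow_natCast]
        push_cast
        rfl
    _ ≤ (2 : ℝ) ^ ((n : ℝ) / 2 + 5) :=
        Real.rpow_le_rpow_of_exponent_le (by norm_num) (by linarith)
    _ = 32 * (2 : ℝ) ^ ((n : ℝ) / 2) := by
        rw [Real.rpow_add (by norm_num), mul_comm]
        norm_num
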